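/- Let $\mathbb{TP}^{n-1}=\mathbb R^n/\mathbb R(1,\dots,1)$ with $n\ge 1$, let $L\subseteq\mathbb{TP}^{n-1}$ be a linear subspace of dimension $d$, let $M_L$ be a real $d\times n$ matrix whose rows represent a basis of $L$, and let $V_L=(v_1,\dots,v_n)$ be the configuration of the columns of $M_L$ in $\mathbb R^d$ (points may coincide; they are distinguished by their labels). For $k\ge 0$ the $k$-th tropical secant variety $S^k(L)\subseteq\mathbb{TP}^{n-1}$ is the set of classes of the coordinatewise minima of $k+1$ vectors in $\mathbb R^n$ whose classes lie in $L$. For a height vector $x\in\mathbb R^n$, a *facet* is a set of labels $A=\{i : x_i=f(v_i)\}$, where $f$ is an affine functional on $\mathbb R^d$ with $x_i\le f(v_i)$ for all $i$, such that $\{v_i : i\in A\}$ affinely spans $\mathbb R^d$. The set of all facets is the regular subdivision of $V_L$ induced by $x$. A subdivision $T$ refines $T'$ if each facet of $T$ is contained in a facet of $T'$. The secondary cone $C(T)\subseteq\mathbb{TP}^{n-1}$ of a regular subdivision $T$ is the set of classes of height vectors whose induced subdivision is refined by $T$, and the secondary fan of $V_L$ is the collection of all these cones. A polytopal complex is a finite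 collection of polytopes in a real vector space that contains the empty polytope, is closed under taking faces, and in which any two members meet in a common face; $|K|$ denotes the union of its members. The cone from $L$ over a set $P$ is $L * P := L\cup\{l+tp : l\in L,\ t>0,\ p\in P\}$. Then there is a polytopal complex $K$ in $\mathbb{TP}^{n-1}$ (called a $k$-th tropical secant complex of $L$) with the following properties. 1. $S^k(L)=L*|K|$, and this cone is non-degenerate: for $l\in L$, $t>0$, $p\in|K|$, the point $l+tp$ is not in $L$ and determines $l$, $t$ and $p$. 2. There is a bijection $F\mapsto T_F$ from the faces of $K$ (the empty face included) onto the regular subdivisions of $V_L$ that have $k+1$ not necessarily distinct facets whose union contains all labels $1,\dots,n$. For all faces $F,G$ of $K$, we have $G\subseteq F$ if and only if $T_F$ refines $T_G$, and $L*F=C(T_F)$. 3. The cones $L*F$, for $F$ a face of $K$, form a subcomplex of the secondary fan of $V_L$: each of them belongs to the secondary fan, and each non-empty face of one of them is again one of them. -/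

import Mathlib

/-! Tropical secant varieties of ordinary linear subspaces of tropical projective space,
regular subdivisions of (labelled) point configurations, and polytopal complexes. -/

namespace TropSec

/-- Tropical projective space `TP^{n-1} = ℝⁿ / ℝ(1,…,1)`, a real vector space. -/
abbrev TP (n : ℕ) : Type := (Fin n → ℝ) ⧸ Submodule.span ℝ {(1 : Fin n → ℝ)}

/-- The projection `ℝⁿ → TP^{n-1}`. -/
abbrev proj (n : ℕ) : (Fin n → ℝ) →ₗ[ℝ] TP n :=
  Submodule.mkQ (Submodule.span ℝ {(1 : Fin n → ℝ)})

/-- The tropical (min-plus) sum `y₀ ⊕ ⋯ ⊕ yₖ`, the coordinatewise minimum. -/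
noncomputable def tropSum {n k : ℕ} (y : Fin (k + 1) → Fin n → ℝ) : Fin n → ℝ :=
  fun i => Finset.univ.inf' Finset.univ_nonempty (fun j => y j i)

/-- The `k`-th tropical secant variety of `L ⊆ TP^{n-1}`: all tropical sums of `k + 1`
representatives of points of `L`. -/
def secantVariety {n : ℕ} (k : ℕ) (L : Submodule ℝ (TP n)) : Set (TP n) :=
  {x | ∃ y : Fin (k + 1) → Fin n → ℝ, (∀ j, proj n (y j) ∈ L) ∧ x = proj n (tropSum y)}

/-! ### Point configurations and regular subdivisions -/

/-- The configuration of the columns of a `d × n` matrix: `n` labelled points in `ℝᵈ`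
(points with different labels may coincide). -/
def columns {d n : ℕ} (M : Matrix (Fin d) (Fin n) ℝ) : Fin n → (Fin d → ℝ) :=
  fun i a => M a i

/-- The facets of the upper envelope of the lifted points `(v i, x i)`, each recorded as the set
of labels of the lifted points lying on it: a set of labels is a facet if it is the contact
set of a non-vertical hyperplane (graph of an affine functional `f`) that lies weakly above all
lifted points, and the points `v i` with labels in it affinely span `ℝᵈ`.
This collection is the regular subdivision of `v` induced by the height vector `x`. -/
def upperFacets {d n : ℕ} (v : Fin n → (Fin d → ℝ)) (x : Fin n → ℝ) : Set (Set (Fin n)) :=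
  {A | ∃ f : (Fin d → ℝ) →ᵃ[ℝ] ℝ, (∀ i, x i ≤ f (v i)) ∧ A = {i | x i = f (v i)} ∧
    affineSpan ℝ (v '' A) = ⊤}

/-- A regular subdivision of `v`, given by its facets (maximal cells). -/
def IsRegularSubdivision {d n : ℕ} (v : Fin n → (Fin d → ℝ)) (T : Set (Set (Fin n))) : Prop :=
  ∃ x : Fin n → ℝ, T = upperFacets v x

/-- `S` refines `T`: every cell of `S` is contained in a cell of `T`. -/
def Refines {n : ℕ} (S T : Set (Set (Fin n))) : Prop :=
  ∀ A ∈ S, ∃ B ∈ T, A ⊆ B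

/-- There are `m` facets of `T`, not necessarily distinct, that together contain every point. -/
def CoveredBy {n : ℕ} (m : ℕ) (T : Set (Set (Fin n))) : Prop :=
  ∃ A : Fin m → Set (Fin n), (∀ j, A j ∈ T) ∧ (⋃ j, A j) = Set.univ

/-- The (closed) secondary cone of a subdivision `T`, in `TP^{n-1}`: the classes of height vectors
whose induced regular subdivision is `T` or a coarsening of `T`. -/
def secondaryCone {d n : ℕ} (v : Fin n → (Fin d → ℝ)) (T : Set (Set (Fin n))) : Set (TP n) :=
  {p | ∃ x : Fin n → ℝ, p = proj n x ∧ Refines T (upperFacets v x)}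

/-- The secondary fan of `v`, as the collection of secondary cones of all regular subdivisions. -/
def secondaryFan {d n : ℕ} (v : Fin n → (Fin d → ℝ)) : Set (Set (TP n)) :=
  {C | ∃ T, IsRegularSubdivision v T ∧ C = secondaryCone v T}

/-! ### Polytopes, polytopal complexes, cones from a linear subspace -/

section Complexes

variable {E : Type*} [AddCommGroup E] [Module ℝ E]

/-- A polytope: the convex hull of a finite (possibly empty) set of points. -/
def IsPolytope (P : Set E) : Prop :=
  ∃ s : Set E, s.Finite ∧ P = convexHull ℝ s

/-- `F` is a face of `P`: the set of points of `P` at which some valid linear inequality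
`φ ≤ c` is tight. The whole of `P` (`0 ≤ 0`) and the empty set (`0 ≤ 1`) are faces. -/
def IsFace (F P : Set E) : Prop :=
  ∃ (φ : E →ₗ[ℝ] ℝ) (c : ℝ), (∀ x ∈ P, φ x ≤ c) ∧ F = {x ∈ P | φ x = c}

/-- The cone from the linear subspace `L` over `P`: the union of `L` and of all `l + t p` with
`l ∈ L`, `t > 0`, `p ∈ P`. In particular the cone over the empty set is `L`. -/
def coneFrom (L : Submodule ℝ E) (P : Set E) : Set E :=
  (L : Set E) ∪ {x | ∃ l ∈ L, ∃ t : ℝ, 0 < t ∧ ∃ p ∈ P, x = l + t • p}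

/-- The cone from `L` over `P` is non-degenerate: no point `l + t p` with `t > 0` lies
in `L`, and `l`, `t`, `p` are determined by `l + t p`. -/
def ProperConeFrom (L : Submodule ℝ E) (P : Set E) : Prop :=
  (∀ l ∈ L, ∀ t : ℝ, 0 < t → ∀ p ∈ P, l + t • p ∉ L) ∧
  (∀ l ∈ L, ∀ l' ∈ L, ∀ t t' : ℝ, 0 < t → 0 < t' → ∀ p ∈ P, ∀ p' ∈ P,
    l + t • p = l' + t' • p' → l = l' ∧ t = t' ∧ p = p')

/-- `𝒟` is a subcomplex of the collection of cones `𝒞`: a subcollection closed under passing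
to (non-empty) faces. -/
def IsSubcomplex (𝒟 𝒞 : Set (Set E)) : Prop :=
  𝒟 ⊆ 𝒞 ∧ ∀ C ∈ 𝒟, ∀ F : Set E, F.Nonempty → IsFace F C → F ∈ 𝒟

end Complexes

/-- A polytopal complex in a real vector space: a finite collection of polytopes, containing the
empty polytope, closed under passing to faces, and in which any two polytopes meet in a common
face. -/
structure PolytopalComplex (E : Type*) [AddCommGroup E] [Module ℝ E] where
  faces : Set (Set E)
  finite : faces.Finite
  isPolytope : ∀ P ∈ faces, IsPolytope P
  empty_mem : ∅ ∈ faces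
  face_mem : ∀ P ∈ faces, ∀ F : Set E, IsFace F P → F ∈ faces
  inter_isFace : ∀ P ∈ faces, ∀ Q ∈ faces, IsFace (P ∩ Q) P ∧ IsFace (P ∩ Q) Q

/-- The underlying set of a polytopal complex. -/
def PolytopalComplex.support {E : Type*} [AddCommGroup E] [Module ℝ E]
    (K : PolytopalComplex E) : Set E :=
  ⋃₀ K.faces

end TropSec

namespace TropSec

/-! ### Polyhedral cones and their slices -/

/-! Let `Λ` be the preimage of `L` in `ℝⁿ`. It contains the constants and consists of the value
vectors of affine functionals at the columns of `M`, so a facet for `x` is the contact set of some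
`l ∈ Λ` above `x` that determines `l` within `Λ`.

If `x` is the minimum of `k + 1` members of `Λ`, their contact sets with `x` cover all labels, and
each extends to a facet (`exists_facet_superset`). Conversely, the functions belonging to `k + 1`
covering facets have minimum `x`. Coarsening preserves covering, so `S^k(L)` is a union of secondary
cones (`secantVariety_eq_iUnion`), closed under passing to faces.

The fan properties rest on linear programming over `Λ`. A functional monotone on `Λ` is minimized,
among the functions above `w`, at a facet (`exists_optimal_facet`), and this facet stays optimal on
the whole cone of `w`. Hence cells of a coarsening contain cells of the refinement
(`exists_facet_subset`), and faces and intersections of cones are cones of their generic members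
(`exists_generic`).

The same principle shows that the least total excess `∑ (l i - x i)` over `l ∈ Λ` above `x` is
linear on each cone. It vanishes exactly on `Λ`. Slicing the cones at grade one inside a complement
of `L` therefore gives polytopes, and these form the complex. -/

theorem exists_step {κ : Type*} [Finite κ] {a b : κ → ℝ} (ha : ∀ i, 0 ≤ a i)
    (hab : ∀ i, a i = 0 → 0 ≤ b i) (hb : ∃ i, b i < 0) :
    ∃ t : ℝ, 0 < t ∧ (∀ i, 0 ≤ a i + t * b i) ∧ ∃ i, a i ≠ 0 ∧ a i + t * b i = 0 := by
  -- Ratio test: the smallest ratio `a i / -b i` is the moment when the first coordinate reaches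
  -- zero.
  obtain ⟨i, hi, hmin⟩ := Set.exists_min_image {i | b i < 0} (fun i => a i / -b i)
    (Set.toFinite _) hb
  simp only [Set.mem_ofPred_eq] at hi hmin
  have hne : ∀ j, b j < 0 → 0 < a j := fun j hj =>
    lt_of_le_of_ne (ha j) fun h => absurd (hab j h.symm) (not_le.2 hj)
  have ht : 0 < a i / -b i := div_pos (hne i hi) (by linarith)
  refine ⟨a i / -b i, ht, fun j => ?_, i, (hne i hi).ne', ?_⟩
  · rcases lt_or_ge (b j) 0 with hj | hj
    · have h := hmin j hj
      rw [le_div_iff₀ (by linarith)] at h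
      linarith
    · have := ha j
      positivity
  · have : b i ≠ 0 := hi.ne
    field_simp
    ring

theorem exists_small_step {κ : Type*} [Finite κ] {a b : κ → ℝ} (ha : ∀ i, 0 ≤ a i)
    (hab : ∀ i, a i = 0 → 0 ≤ b i) :
    ∃ t : ℝ, 0 < t ∧ ∀ i, 0 ≤ a i + t * b i := by
  by_cases hb : ∃ i, b i < 0
  · obtain ⟨t, ht, h, -⟩ := exists_step ha hab hb
    exact ⟨t, ht, h⟩
  · push Not at hb
    exact ⟨1, one_pos, fun i => by linarith [ha i, hb i]⟩

section Polyhedra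

variable {E : Type*} [AddCommGroup E] [Module ℝ E]

/-- A polyhedral cone: the solution set of finitely many homogeneous linear inequalities. -/
def IsPolyhedralCone (C : Set E) : Prop :=
  ∃ (κ : Type) (_ : Finite κ) (α : κ → E →ₗ[ℝ] ℝ), C = {x | ∀ a, 0 ≤ α a x}

theorem IsPolyhedralCone.add_mem {C : Set E} (hC : IsPolyhedralCone C) {x y : E} (hx : x ∈ C)
    (hy : y ∈ C) : x + y ∈ C := by
  obtain ⟨κ, _, α, rfl⟩ := hC
  intro a
  rw [map_add]
  exact add_nonneg (hx a) (hy a)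

theorem IsPolyhedralCone.smul_mem {C : Set E} (hC : IsPolyhedralCone C) {x : E} (hx : x ∈ C)
    {t : ℝ} (ht : 0 ≤ t) : t • x ∈ C := by
  obtain ⟨κ, _, α, rfl⟩ := hC
  intro a
  rw [map_smul]
  exact mul_nonneg ht (hx a)

theorem IsPolyhedralCone.comap {E' : Type*} [AddCommGroup E'] [Module ℝ E'] {C : Set E}
    (hC : IsPolyhedralCone C) (f : E' →ₗ[ℝ] E) : IsPolyhedralCone (f ⁻¹' C) := by
  obtain ⟨κ, hκ, α, rfl⟩ := hC
  exact ⟨κ, hκ, fun a => (α a).comp f, rfl⟩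

theorem IsPolytope.image {E' : Type*} [AddCommGroup E'] [Module ℝ E'] {P : Set E}
    (hP : IsPolytope P) (f : E →ₗ[ℝ] E') : IsPolytope (f '' P) := by
  obtain ⟨s, hs, rfl⟩ := hP
  exact ⟨f '' s, hs.image f, f.image_convexHull s⟩

/-- A slice of a polyhedral cone by a functional that is positive away from the apex is a
polytope. -/
theorem IsPolyhedralCone.isPolytope_slice {C : Set E} (hC : IsPolyhedralCone C)
    (g : E →ₗ[ℝ] ℝ) (hg : ∀ x ∈ C, x ≠ 0 → 0 < g x) : IsPolytope {x | x ∈ C ∧ g x = 1} := by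
  obtain ⟨κ, _, α, rfl⟩ := hC
  set Q : Set E := {x | x ∈ {x | ∀ a, 0 ≤ α a x} ∧ g x = 1} with hQ
  set Z : E → Set κ := fun x => {a | α a x = 0} with hZ
  -- Vertices are the points determined by their active constraints; there are finitely many, since
  -- `Z` is injective on them.
  set V : Set E := {p | p ∈ Q ∧ ∀ q ∈ Q, Z p ⊆ Z q → q = p} with hV
  have hVfin : V.Finite := by
    refine Set.Finite.of_finite_image (f := Z) (Set.toFinite _) ?_
    intro p hp q hq hpq
    exact (hp.2 q hq.1 hpq.subset).symm
  have hQconv : Convex ℝ Q := by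
    intro x hx y hy a b ha hb hab
    refine ⟨fun c => ?_, ?_⟩
    · simp only [map_add, map_smul, smul_eq_mul]
      exact add_nonneg (mul_nonneg ha (hx.1 c)) (mul_nonneg hb (hy.1 c))
    · simp only [map_add, map_smul, smul_eq_mul, hx.2, hy.2]
      linarith
  have hmove : ∀ p ∈ Q, ∀ r : E, r ≠ 0 → g r = 0 → (∀ a ∈ Z p, α a r = 0) →
      ∃ t : ℝ, 0 < t ∧ p + t • r ∈ Q ∧ Z p ⊂ Z (p + t • r) := by
    intro p hp r hr hgr hZr
    -- Otherwise `r` would be a nonzero element of the cone with `g r = 0`: this is where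
    -- boundedness of the slice enters.
    have hneg : ∃ a, α a r < 0 := by
      by_contra! h
      exact (hg r h hr).ne' hgr
    obtain ⟨t, ht, h1, a, ha, hat⟩ := exists_step (a := fun a => α a p) (b := fun a => α a r)
      hp.1 (fun a ha => (hZr a ha).ge) hneg
    refine ⟨t, ht, ⟨fun a => ?_, ?_⟩, ?_⟩
    · simpa using h1 a
    · simp [hp.2, hgr]
    · refine (Set.ssubset_iff_of_subset fun b hb => ?_).2 ⟨a, ?_, ha⟩
      · have h2 := hZr b hb
        simp only [hZ, Set.mem_ofPred_eq] at hb ⊢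
        simp [hb, h2]
      · simpa [hZ] using hat
  -- Induction on the number of inactive constraints. A point that is no vertex lies between two
  -- points with more active constraints, reached by moving in opposite directions.
  have hmem : ∀ m : ℕ, ∀ p ∈ Q, (Z p)ᶜ.ncard = m → p ∈ convexHull ℝ V := by
    intro m
    induction m using Nat.strong_induction_on with
    | _ m ih =>
      intro p hp hm
      by_cases hpV : p ∈ V
      · exact subset_convexHull ℝ V hpV
      · have : ∃ q ∈ Q, Z p ⊆ Z q ∧ q ≠ p := by
          by_contra! h
          exact hpV ⟨hp, h⟩
        obtain ⟨q, hq, hpq, hne⟩ := this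
        have hr : q - p ≠ 0 := sub_ne_zero.2 hne
        have hgr : g (q - p) = 0 := by simp [hp.2, hq.2]
        have hZr : ∀ a ∈ Z p, α a (q - p) = 0 := by
          intro a ha
          have h1 : α a q = 0 := hpq ha
          have h2 : α a p = 0 := ha
          simp [h1, h2]
        obtain ⟨s, hs, hsQ, hsZ⟩ := hmove p hp (q - p) hr hgr hZr
        obtain ⟨t, ht, htQ, htZ⟩ := hmove p hp (-(q - p)) (neg_ne_zero.2 hr) (by rw [map_neg, hgr, neg_zero])
          (fun a ha => by rw [map_neg, hZr a ha, neg_zero])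
        have hlt : ∀ y, Z p ⊂ Z y → (Z y)ᶜ.ncard < m := fun y hy => by
          rw [← hm]
          exact Set.ncard_lt_ncard (compl_lt_compl_iff_lt.2 hy) (Set.toFinite _)
        have h1 := ih _ (hlt _ hsZ) _ hsQ rfl
        have h2 := ih _ (hlt _ htZ) _ htQ rfl
        have h3 := (convex_convexHull ℝ V) h1 h2 (a := t / (s + t)) (b := s / (s + t))
          (by positivity) (by positivity) (by field_simp; ring)
        convert h3 using 1
        have hst : s + t ≠ 0 := by positivity
        have e : (t / (s + t)) * s = (s / (s + t)) * t := by ring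
        have e1 : t / (s + t) + s / (s + t) = 1 := by field_simp; ring
        rw [smul_add, smul_add, smul_smul, smul_smul, e, smul_neg]
        rw [show (t / (s + t)) • p + ((s / (s + t)) * t) • (q - p) +
          ((s / (s + t)) • p + -(((s / (s + t)) * t) • (q - p))) =
          (t / (s + t) + s / (s + t)) • p by rw [add_smul]; abel, e1, one_smul]
  refine ⟨V, hVfin, Set.Subset.antisymm (fun p hp => hmem _ p hp rfl) ?_⟩
  exact convexHull_min (fun p hp => hp.1) hQconv

/-! ### The polytopal complex cut out of a fan -/

/-- A finite family of polyhedral cones that is closed under faces, meets in common faces and has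
`L` as its smallest member, together with a function, linear on each cone, that is positive
outside `L`. -/
structure IsGradedFan (L : Submodule ℝ E) {ι : Type*} (C : ι → Set E)
    (g : ι → E →ₗ[ℝ] ℝ) : Prop where
  polyhedral : ∀ i, IsPolyhedralCone (C i)
  le : ∀ i, (L : Set E) ⊆ C i
  grade_eq_zero : ∀ i, ∀ x ∈ L, g i x = 0
  grade_pos : ∀ i, ∀ x ∈ C i, x ∉ L → 0 < g i x
  grade_eq : ∀ i j, ∀ x ∈ C i, x ∈ C j → g i x = g j x
  inter_isFace : ∀ i j, IsFace (C i ∩ C j) (C i)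
  face : ∀ i, ∀ F : Set E, F.Nonempty → IsFace F (C i) → ∃ j, F = C j
  bot : ∃ i, C i = L

/-- The part of grade one, within a complement `W` of the lineality space. -/
def slice (W : Submodule ℝ E) (C : Set E) (g : E →ₗ[ℝ] ℝ) : Set E :=
  {x | x ∈ C ∧ x ∈ W ∧ g x = 1}

theorem IsFace.slice {C F : Set E} (hF : IsFace F C) (h0 : (0 : E) ∈ F) (W : Submodule ℝ E)
    {g g' : E →ₗ[ℝ] ℝ} (hg : ∀ x ∈ F, g x = g' x) :
    IsFace (slice W F g') (TropSec.slice W C g) := by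
  obtain ⟨φ, c, hφ, rfl⟩ := hF
  refine ⟨φ, c, fun x hx => hφ x hx.1, ?_⟩
  ext x
  constructor
  · rintro ⟨h1, h2, h3⟩
    exact ⟨⟨h1.1, h2, (hg x h1).trans h3⟩, h1.2⟩
  · rintro ⟨⟨h1, h2, h3⟩, h4⟩
    exact ⟨⟨h1, h4⟩, h2, (hg x ⟨h1, h4⟩).symm.trans h3⟩

namespace IsGradedFan

variable {L W : Submodule ℝ E} {ι : Type*} {C : ι → Set E} {g : ι → E →ₗ[ℝ] ℝ}

theorem coneFrom_slice (h : IsGradedFan L C g) (hW : IsCompl L W) (i : ι) :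
    coneFrom L (slice W (C i) (g i)) = C i := by
  apply Set.Subset.antisymm
  · rintro x (hx | ⟨l, hl, t, ht, p, hp, rfl⟩)
    · exact h.le i hx
    · exact (h.polyhedral i).add_mem (h.le i hl) ((h.polyhedral i).smul_mem hp.1 ht.le)
  · intro x hx
    by_cases hxL : x ∈ L
    · exact Or.inl hxL
    obtain ⟨l, hl, w, hw, rfl⟩ := Submodule.mem_sup.1
      (show x ∈ L ⊔ W by rw [hW.sup_eq_top]; trivial)
    have hpos := h.grade_pos i _ hx hxL
    rw [map_add, h.grade_eq_zero i l hl, zero_add] at hpos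
    have hwC : w ∈ C i := by
      have := (h.polyhedral i).add_mem (h.le i (L.neg_mem hl)) hx
      rwa [neg_add_cancel_left] at this
    refine Or.inr ⟨l, hl, g i w, hpos, (g i w)⁻¹ • w,
      ⟨(h.polyhedral i).smul_mem hwC (inv_nonneg.2 hpos.le), W.smul_mem _ hw, ?_⟩, ?_⟩
    · simp [hpos.ne']
    · rw [smul_inv_smul₀ hpos.ne']

theorem slice_subset_slice (h : IsGradedFan L C g) {i j : ι} (hij : C i ⊆ C j) :
    slice W (C i) (g i) ⊆ slice W (C j) (g j) := fun x hx =>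
  ⟨hij hx.1, hx.2.1, (h.grade_eq j i x (hij hx.1) hx.1).trans hx.2.2⟩

theorem slice_subset_slice_iff (h : IsGradedFan L C g) (hW : IsCompl L W) {i j : ι} :
    slice W (C i) (g i) ⊆ slice W (C j) (g j) ↔ C i ⊆ C j := by
  refine ⟨fun hs => ?_, h.slice_subset_slice⟩
  rw [← h.coneFrom_slice hW i, ← h.coneFrom_slice hW j]
  rintro x (hx | ⟨l, hl, t, ht, p, hp, rfl⟩)
  · exact Or.inl hx
  · exact Or.inr ⟨l, hl, t, ht, p, hs hp, rfl⟩

theorem isPolytope_slice (h : IsGradedFan L C g) (hW : IsCompl L W) (i : ι) :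
    IsPolytope (slice W (C i) (g i)) := by
  have hp := (((h.polyhedral i).comap W.subtype).isPolytope_slice ((g i).comp W.subtype) ?_).image
    W.subtype
  · convert hp using 1
    ext x
    constructor
    · rintro ⟨h1, h2, h3⟩
      exact ⟨⟨x, h2⟩, ⟨h1, h3⟩, rfl⟩
    · rintro ⟨y, ⟨h1, h2⟩, rfl⟩
      exact ⟨h1, y.2, h2⟩
  · intro x hx hx0
    refine h.grade_pos i _ hx fun hxL => hx0 ?_
    exact Subtype.ext (Submodule.disjoint_def.1 hW.disjoint _ hxL x.2)

/-- The inequality `φ ≤ c` on the slice homogenizes to `φ - c • g i ≤ 0` on the cone, after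
projecting along `L` so that it vanishes there. The resulting face of the cone belongs to the fan.
-/
theorem exists_eq_slice_of_isFace (h : IsGradedFan L C g) (hW : IsCompl L W) (i : ι) {F : Set E}
    (hF : IsFace F (slice W (C i) (g i))) : ∃ j, F = slice W (C j) (g j) := by
  obtain ⟨φ, c, hφ, rfl⟩ := hF
  set ψ : E →ₗ[ℝ] ℝ := (φ - c • g i).comp (W.projection L hW.symm) with hψ
  have hψW : ∀ w ∈ W, ψ w = φ w - c * g i w := fun w hw => by
    simp [hψ, Submodule.projection_apply_of_mem_left hW.symm hw]
  have hψL : ∀ l ∈ L, ψ l = 0 := fun l hl => by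
    simp only [hψ, LinearMap.comp_apply]
    rw [Submodule.projection_apply_of_mem_right hW.symm hl, map_zero]
  have hψC : ∀ x ∈ C i, ψ x ≤ 0 := by
    intro x hx
    rw [← h.coneFrom_slice hW i] at hx
    rcases hx with hx | ⟨l, hl, t, ht, p, hp, rfl⟩
    · exact (hψL x hx).le
    · rw [map_add, hψL l hl, map_smul, hψW p hp.2.1, hp.2.2, smul_eq_mul]
      nlinarith [hφ p hp]
  obtain ⟨j, hj⟩ := h.face i {x ∈ C i | ψ x = 0}
    ⟨0, h.le i L.zero_mem, map_zero ψ⟩ ⟨ψ, 0, hψC, rfl⟩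
  have hjC : ∀ x, x ∈ C j ↔ x ∈ C i ∧ ψ x = 0 := fun x => by rw [← hj]; rfl
  refine ⟨j, Set.ext fun x => ⟨?_, ?_⟩⟩
  · rintro ⟨⟨h1, h2, h3⟩, h4⟩
    have hxj : x ∈ C j := (hjC x).2 ⟨h1, by rw [hψW x h2, h3, h4]; ring⟩
    exact ⟨hxj, h2, (h.grade_eq j i x hxj h1).trans h3⟩
  · rintro ⟨h1, h2, h3⟩
    obtain ⟨h4, h5⟩ := (hjC x).1 h1
    have h6 : g i x = 1 := (h.grade_eq i j x h4 h1).trans h3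
    refine ⟨⟨h4, h2, h6⟩, ?_⟩
    rw [hψW x h2, h6] at h5
    linarith

theorem isFace_slice_inter (h : IsGradedFan L C g) (i j : ι) :
    IsFace (slice W (C i) (g i) ∩ slice W (C j) (g j)) (slice W (C i) (g i)) := by
  have := (h.inter_isFace i j).slice ⟨h.le i L.zero_mem, h.le j L.zero_mem⟩ W
    (g := g i) (g' := g i) (fun _ _ => rfl)
  convert this using 1
  ext x
  constructor
  · rintro ⟨h1, h2⟩
    exact ⟨⟨h1.1, h2.1⟩, h1.2⟩
  · rintro ⟨⟨h1, h2⟩, h3, h4⟩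
    exact ⟨⟨h1, h3, h4⟩, h2, h3, (h.grade_eq j i x h2 h1).trans h4⟩

/-- The slices of the cones of a graded fan form a polytopal complex. -/
def complex [Finite ι] (h : IsGradedFan L C g) (hW : IsCompl L W) : PolytopalComplex E where
  faces := Set.range fun i => slice W (C i) (g i)
  finite := Set.finite_range _
  isPolytope := by
    rintro _ ⟨i, rfl⟩
    exact h.isPolytope_slice hW i
  empty_mem := by
    -- The smallest cone `L` has grade zero throughout, so its slice is the empty face.
    obtain ⟨i, hi⟩ := h.bot
    refine ⟨i, Set.eq_empty_of_forall_notMem ?_⟩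
    rintro x ⟨h1, h2, h3⟩
    rw [hi] at h1
    rw [h.grade_eq_zero i x h1] at h3
    exact zero_ne_one h3
  face_mem := by
    rintro _ ⟨i, rfl⟩ F hF
    obtain ⟨j, hj⟩ := h.exists_eq_slice_of_isFace hW i hF
    exact ⟨j, hj.symm⟩
  inter_isFace := by
    rintro _ ⟨i, rfl⟩ _ ⟨j, rfl⟩
    refine ⟨h.isFace_slice_inter i j, ?_⟩
    rw [Set.inter_comm]
    exact h.isFace_slice_inter j i

theorem mem_support_complex [Finite ι] (h : IsGradedFan L C g) (hW : IsCompl L W) {x : E} :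
    x ∈ (h.complex hW).support ↔ ∃ i, x ∈ slice W (C i) (g i) := by
  simp [PolytopalComplex.support, complex]

theorem coneFrom_support [Finite ι] (h : IsGradedFan L C g) (hW : IsCompl L W) :
    coneFrom L (h.complex hW).support = ⋃ i, C i := by
  ext x
  rw [Set.mem_iUnion]
  constructor
  · rintro (hx | ⟨l, hl, t, ht, p, hp, rfl⟩)
    · obtain ⟨i, -⟩ := h.bot
      exact ⟨i, h.le i hx⟩
    · obtain ⟨i, hi⟩ := (h.mem_support_complex hW).1 hp
      refine ⟨i, ?_⟩
      rw [← h.coneFrom_slice hW i]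
      exact Or.inr ⟨l, hl, t, ht, p, hi, rfl⟩
  · rintro ⟨i, hx⟩
    rw [← h.coneFrom_slice hW i] at hx
    rcases hx with hx | ⟨l, hl, t, ht, p, hp, rfl⟩
    · exact Or.inl hx
    · exact Or.inr ⟨l, hl, t, ht, p, (h.mem_support_complex hW).2 ⟨i, hp⟩, rfl⟩

theorem properConeFrom_support [Finite ι] (h : IsGradedFan L C g) (hW : IsCompl L W) :
    ProperConeFrom L (h.complex hW).support := by
  have hgrade : ∀ i, ∀ p ∈ slice W (C i) (g i), ∀ l ∈ L, ∀ t : ℝ, g i (l + t • p) = t := by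
    intro i p hp l hl t
    rw [map_add, h.grade_eq_zero i l hl, map_smul, hp.2.2, smul_eq_mul, mul_one, zero_add]
  have hmem : ∀ i, ∀ p ∈ slice W (C i) (g i), ∀ l ∈ L, ∀ t : ℝ, 0 < t → l + t • p ∈ C i := by
    intro i p hp l hl t ht
    exact (h.polyhedral i).add_mem (h.le i hl) ((h.polyhedral i).smul_mem hp.1 ht.le)
  constructor
  · intro l hl t ht p hp hL
    obtain ⟨i, hi⟩ := (h.mem_support_complex hW).1 hp
    have := hgrade i p hi l hl t
    rw [h.grade_eq_zero i _ hL] at this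
    exact ht.ne this
  · intro l hl l' hl' t t' ht ht' p hp p' hp' heq
    obtain ⟨i, hi⟩ := (h.mem_support_complex hW).1 hp
    obtain ⟨j, hj⟩ := (h.mem_support_complex hW).1 hp'
    have htt : t = t' := by
      rw [← hgrade i p hi l hl t, ← hgrade j p' hj l' hl' t', ← heq]
      exact h.grade_eq i j _ (hmem i p hi l hl t ht) (heq ▸ hmem j p' hj l' hl' t' ht')
    subst htt
    have hdiff : l - l' = t • (p' - p) := by
      rw [smul_sub, sub_eq_sub_iff_add_eq_add, heq, add_comm]
    have h0 : l - l' = 0 := Submodule.disjoint_def.1 hW.disjoint _ (L.sub_mem hl hl')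
      (hdiff ▸ W.smul_mem _ (W.sub_mem hj.2.1 hi.2.1))
    rw [h0] at hdiff
    refine ⟨sub_eq_zero.1 h0, rfl, ?_⟩
    rcases smul_eq_zero.1 hdiff.symm with h1 | h1
    · exact absurd h1 ht.ne'
    · exact (sub_eq_zero.1 h1).symm

end IsGradedFan

end Polyhedra

end TropSec

namespace TropSec

/-! ### Facets and secondary cones relative to a space of functions -/

section Facets

variable {ι : Type} {Λ : Submodule ℝ (ι → ℝ)}

/-- Functions in `Λ` are determined by their values on `A`. -/
def Determines (Λ : Submodule ℝ (ι → ℝ)) (A : Set ι) : Prop :=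
  ∀ l ∈ Λ, (∀ i ∈ A, l i = 0) → l = 0

/-- The contact sets of functions in `Λ` lying weakly above `x`, as far as they determine the
function. -/
def facets (Λ : Submodule ℝ (ι → ℝ)) (x : ι → ℝ) : Set (Set ι) :=
  {A | ∃ l ∈ Λ, (∀ i, x i ≤ l i) ∧ A = {i | x i = l i} ∧ Determines Λ A}

/-- The height vectors that are concave and in `Λ` on every cell of `T`. -/
def heightCone (Λ : Submodule ℝ (ι → ℝ)) (T : Set (Set ι)) : Set (ι → ℝ) :=
  {x | ∀ A ∈ T, ∃ l ∈ Λ, (∀ i, x i ≤ l i) ∧ ∀ i ∈ A, x i = l i}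

theorem Determines.mono {A B : Set ι} (hA : Determines Λ A) (hAB : A ⊆ B) : Determines Λ B :=
  fun l hl h => hA l hl fun i hi => h i (hAB hi)

theorem Determines.eq {A : Set ι} (hA : Determines Λ A) {l l' : ι → ℝ} (hl : l ∈ Λ)
    (hl' : l' ∈ Λ) (h : ∀ i ∈ A, l i = l' i) : l = l' :=
  sub_eq_zero.1 <| hA _ (Λ.sub_mem hl hl') fun i hi => by simp [h i hi]

/-- Restriction to `A` is injective on `Λ`, hence has a linear left inverse. Linearity of the
interpolation is what turns membership in a height cone into linear inequalities. -/
theorem Determines.exists_retraction {A : Set ι} (hA : Determines Λ A) :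
    ∃ β : (ι → ℝ) →ₗ[ℝ] (ι → ℝ), (∀ y, β y ∈ Λ) ∧ (∀ l ∈ Λ, β l = l) ∧
      ∀ y z : ι → ℝ, (∀ i ∈ A, y i = z i) → β y = β z := by
  set R : (ι → ℝ) →ₗ[ℝ] (A → ℝ) := LinearMap.funLeft ℝ ℝ (Subtype.val : A → ι) with hR
  have hker : LinearMap.ker (R.comp Λ.subtype) = ⊥ := by
    rw [LinearMap.ker_eq_bot']
    intro l hl
    exact Subtype.ext (hA l l.2 fun i hi => congrFun hl ⟨i, hi⟩)
  obtain ⟨s, hs⟩ := LinearMap.exists_leftInverse_of_injective _ hker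
  refine ⟨Λ.subtype.comp (s.comp R), fun y => (s (R y)).2, fun l hl => ?_, fun y z h => ?_⟩
  · exact congrArg Subtype.val (LinearMap.congr_fun hs ⟨l, hl⟩)
  · have : R y = R z := funext fun i => h i i.2
    simp [this]

open Classical in
/-- The function in `Λ` interpolating the values on `A`, extended linearly to all vectors. -/
noncomputable def interp (Λ : Submodule ℝ (ι → ℝ)) (A : Set ι) : (ι → ℝ) →ₗ[ℝ] (ι → ℝ) :=
  if h : Determines Λ A then h.exists_retraction.choose else 0

theorem interp_mem {A : Set ι} (hA : Determines Λ A) (y : ι → ℝ) : interp Λ A y ∈ Λ := by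
  rw [interp, dif_pos hA]
  exact hA.exists_retraction.choose_spec.1 y

theorem interp_eq {A : Set ι} (hA : Determines Λ A) {y l : ι → ℝ} (hl : l ∈ Λ)
    (h : ∀ i ∈ A, y i = l i) : interp Λ A y = l := by
  rw [interp, dif_pos hA, hA.exists_retraction.choose_spec.2.2 y l h]
  exact hA.exists_retraction.choose_spec.2.1 l hl

theorem determines_of_mem_facets {x : ι → ℝ} {A : Set ι} (hA : A ∈ facets Λ x) :
    Determines Λ A := by
  obtain ⟨l, -, -, -, h⟩ := hA
  exact h

theorem mem_heightCone_iff {T : Set (Set ι)} (hT : ∀ A ∈ T, Determines Λ A) {x : ι → ℝ} :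
    x ∈ heightCone Λ T ↔
      ∀ A ∈ T, (∀ i, x i ≤ interp Λ A x i) ∧ ∀ i ∈ A, x i = interp Λ A x i := by
  refine forall₂_congr fun A hA => ⟨?_, fun h => ⟨_, interp_mem (hT A hA) x, h⟩⟩
  rintro ⟨l, hl, h1, h2⟩
  rw [interp_eq (hT A hA) hl h2]
  exact ⟨h1, h2⟩

theorem mem_heightCone_iff_refines {T : Set (Set ι)} (hT : ∀ A ∈ T, Determines Λ A)
    {x : ι → ℝ} : x ∈ heightCone Λ T ↔ ∀ A ∈ T, ∃ B ∈ facets Λ x, A ⊆ B := by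
  refine forall₂_congr fun A hA => ⟨?_, ?_⟩
  · rintro ⟨l, hl, h1, h2⟩
    exact ⟨_, ⟨l, hl, h1, rfl, (hT A hA).mono h2⟩, h2⟩
  · rintro ⟨_, ⟨l, hl, h1, rfl, -⟩, h2⟩
    exact ⟨l, hl, h1, h2⟩

theorem mem_heightCone_facets_self (x : ι → ℝ) : x ∈ heightCone Λ (facets Λ x) :=
  (mem_heightCone_iff_refines fun _ => determines_of_mem_facets).2
    fun A hA => ⟨A, hA, subset_rfl⟩

theorem subset_heightCone (T : Set (Set ι)) : (Λ : Set (ι → ℝ)) ⊆ heightCone Λ T :=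
  fun l hl _ _ => ⟨l, hl, fun _ => le_rfl, fun _ _ => rfl⟩

theorem heightCone_add_mem {T : Set (Set ι)} {x y : ι → ℝ} (hx : x ∈ heightCone Λ T)
    (hy : y ∈ heightCone Λ T) : x + y ∈ heightCone Λ T := by
  intro A hA
  obtain ⟨l, hl, h1, h2⟩ := hx A hA
  obtain ⟨m, hm, h3, h4⟩ := hy A hA
  exact ⟨l + m, Λ.add_mem hl hm, fun i => add_le_add (h1 i) (h3 i),
    fun i hi => by simp [h2 i hi, h4 i hi]⟩

theorem facets_antichain {x : ι → ℝ} {A B : Set ι} (hA : A ∈ facets Λ x)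
    (hB : B ∈ facets Λ x) (hAB : A ⊆ B) : A = B := by
  obtain ⟨l, hl, -, rfl, hd⟩ := hA
  obtain ⟨m, hm, -, rfl, -⟩ := hB
  rw [hd.eq hl hm fun i hi => (show x i = l i from hi).symm.trans (hAB hi)]

theorem facets_zero : facets Λ 0 = {Set.univ} := by
  ext A
  rw [Set.mem_singleton_iff]
  constructor
  · rintro ⟨l, hl, -, rfl, hd⟩
    rw [hd l hl fun i hi => (show 0 = l i from hi).symm]
    simp
  · rintro rfl
    exact ⟨0, Λ.zero_mem, fun _ => le_rfl, by simp, fun l _ h => funext fun i => h i trivial⟩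

theorem heightCone_univ : heightCone Λ {Set.univ} = Λ := by
  refine Set.Subset.antisymm (fun x hx => ?_) (subset_heightCone _)
  obtain ⟨l, hl, -, h⟩ := hx _ rfl
  rw [show x = l from funext fun i => h i trivial]
  exact hl

theorem heightCone_facets_subset {w y : ι → ℝ} (hy : y ∈ heightCone Λ (facets Λ w)) :
    heightCone Λ (facets Λ y) ⊆ heightCone Λ (facets Λ w) := by
  intro z hz A hA
  obtain ⟨B, hB, hAB⟩ :=
    (mem_heightCone_iff_refines fun _ => determines_of_mem_facets).1 hy A hA
  obtain ⟨l, hl, h2, h3⟩ := hz B hB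
  exact ⟨l, hl, h2, fun i hi => h3 i (hAB hi)⟩

theorem interp_eq_of_interp_eq {w y z : ι → ℝ} (hy : y ∈ heightCone Λ (facets Λ w))
    (hz : z ∈ heightCone Λ (facets Λ y)) {A : Set ι} (hA : A ∈ facets Λ w) {i : ι}
    (hi : y i = interp Λ A y i) : z i = interp Λ A z i := by
  have hd := determines_of_mem_facets hA
  obtain ⟨l, hl, h2, h3⟩ := hy A hA
  obtain ⟨m, hm, -, h5⟩ := hz _ ⟨l, hl, h2, rfl, hd.mono h3⟩
  rw [interp_eq hd hl h3] at hi
  rw [interp_eq hd hm fun j hj => h5 j (h3 j hj)]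
  exact h5 i hi

/-! ### Linear programming over `Λ` and the faces of a height cone -/

variable [Fintype ι]

/-- As long as the contact set does not determine `l`, some direction in `Λ` vanishes on it. Its
sign can be chosen so that `u` does not increase and some coordinate decreases; moving along it
enlarges the contact set. -/
theorem exists_vertex_le (u : (ι → ℝ) →ₗ[ℝ] ℝ) (hu : ∀ l ∈ Λ, (∀ i, 0 ≤ l i) → 0 ≤ u l)
    (x : ι → ℝ) {l : ι → ℝ} (hl : l ∈ Λ) (hxl : ∀ i, x i ≤ l i) :
    ∃ m ∈ Λ, (∀ i, x i ≤ m i) ∧ Determines Λ {i | x i = m i} ∧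
      {i | x i = l i} ⊆ {i | x i = m i} ∧ u m ≤ u l := by
  induction hN : ({i | x i = l i}ᶜ : Set ι).ncard using Nat.strong_induction_on generalizing l with
  | _ N ih =>
    by_cases hd : Determines Λ {i | x i = l i}
    · exact ⟨l, hl, hxl, hd, subset_rfl, le_rfl⟩
    have : ∃ r ∈ Λ, (∀ i ∈ {i | x i = l i}, r i = 0) ∧ u r ≤ 0 ∧ ∃ i, r i < 0 := by
      simp only [Determines, not_forall] at hd
      obtain ⟨r, hr, hr0, hne⟩ := hd
      have hneg : ∀ i ∈ {i | x i = l i}, (-r) i = 0 := fun i hi => by simp [hr0 i hi]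
      obtain ⟨i, hi⟩ := Function.ne_iff.1 hne
      rcases lt_trichotomy (u r) 0 with h | h | h
      · refine ⟨r, hr, hr0, h.le, ?_⟩
        by_contra! h'
        exact absurd (hu r hr h') (not_le.2 h)
      · rcases lt_or_gt_of_ne hi with hi | hi
        · exact ⟨r, hr, hr0, h.le, i, hi⟩
        · exact ⟨-r, Λ.neg_mem hr, hneg, by simp [h], i, by simpa using hi⟩
      · refine ⟨-r, Λ.neg_mem hr, hneg, by simpa using h.le, ?_⟩
        by_contra! h'
        have := hu _ (Λ.neg_mem hr) h'
        rw [map_neg] at this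
        linarith
    obtain ⟨r, hr, hr0, hur, hneg⟩ := this
    obtain ⟨t, ht, h1, j, hj, hj0⟩ := exists_step (a := fun i => l i - x i) (b := fun i => r i)
      (fun i => sub_nonneg.2 (hxl i)) (fun i hi => (hr0 i (sub_eq_zero.1 hi).symm).ge) hneg
    have hss : {i | x i = l i} ⊂ {i | x i = (l + t • r) i} := by
      refine (Set.ssubset_iff_of_subset fun i hi => ?_).2 ⟨j, ?_, fun h => hj ?_⟩
      · have h2 := hr0 i hi
        simp only [Set.mem_ofPred_eq] at hi ⊢
        simp [h2, hi]
      · simp only [Set.mem_ofPred_eq, Pi.add_apply, Pi.smul_apply, smul_eq_mul]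
        linarith
      · rw [show x j = l j from h, sub_self]
    obtain ⟨m, hm, h2, h3, h4, h5⟩ := ih _
      (hN ▸ Set.ncard_lt_ncard (compl_lt_compl_iff_lt.2 hss) (Set.toFinite _))
      (l := l + t • r) (Λ.add_mem hl (Λ.smul_mem _ hr))
      (fun i => by
        have := h1 i
        simp only [Pi.add_apply, Pi.smul_apply, smul_eq_mul]
        linarith) rfl
    refine ⟨m, hm, h2, h3, hss.subset.trans h4, h5.trans ?_⟩
    rw [map_add, map_smul, smul_eq_mul]
    nlinarith

theorem exists_facet_superset {x l : ι → ℝ} (hl : l ∈ Λ) (hxl : ∀ i, x i ≤ l i) :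
    ∃ A ∈ facets Λ x, {i | x i = l i} ⊆ A := by
  obtain ⟨m, hm, h1, h2, h3, -⟩ := exists_vertex_le 0 (fun _ _ _ => le_rfl) x hl hxl
  exact ⟨_, ⟨m, hm, h1, rfl, h2⟩, h3⟩

/-- A functional that is monotone on `Λ` is minimized at a facet, and then monotone with respect
to the values on this facet. -/
theorem exists_optimal_facet (h1 : (1 : ι → ℝ) ∈ Λ) (u : (ι → ℝ) →ₗ[ℝ] ℝ)
    (hu : ∀ l ∈ Λ, (∀ i, 0 ≤ l i) → 0 ≤ u l) (x : ι → ℝ) :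
    ∃ A ∈ facets Λ x, ∀ r ∈ Λ, (∀ i ∈ A, 0 ≤ r i) → 0 ≤ u r := by
  set V : Set (ι → ℝ) := {m | m ∈ Λ ∧ (∀ i, x i ≤ m i) ∧ Determines Λ {i | x i = m i}} with hV
  have hVfin : V.Finite := by
    refine Set.Finite.of_finite_image (f := fun m => {i | x i = m i}) (Set.toFinite _) ?_
    intro p hp q hq hpq
    refine hp.2.2.eq hp.1 hq.1 fun i hi => ?_
    have h2 : x i = q i := (Set.ext_iff.1 hpq i).1 hi
    exact (show x i = p i from hi).symm.trans h2
  have hVne : V.Nonempty := by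
    obtain ⟨c, hc⟩ := (Set.finite_range x).bddAbove
    obtain ⟨m, hm, h2, h3, -⟩ := exists_vertex_le u hu x (Λ.smul_mem c h1)
      (fun i => by simpa using hc ⟨i, rfl⟩)
    exact ⟨m, hm, h2, h3⟩
  obtain ⟨m, hm, hmin⟩ := Set.exists_min_image V u hVfin hVne
  refine ⟨_, ⟨m, hm.1, hm.2.1, rfl, hm.2.2⟩, fun r hr hr0 => ?_⟩
  -- A short step along `r` remains above `x`. If `u r` were negative, a vertex at or below this
  -- point in `u`-value would beat the minimum `m`.
  obtain ⟨t, ht, h2⟩ := exists_small_step (a := fun i => m i - x i) (b := fun i => r i)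
    (fun i => sub_nonneg.2 (hm.2.1 i)) (fun i hi => hr0 i (sub_eq_zero.1 hi).symm)
  obtain ⟨q, hq, h3, h4, -, h5⟩ := exists_vertex_le u hu x (Λ.add_mem hm.1 (Λ.smul_mem t hr))
    (fun i => by
      have := h2 i
      simp only [Pi.add_apply, Pi.smul_apply, smul_eq_mul]
      linarith)
  have h6 := hmin q ⟨hq, h3, h4⟩
  rw [map_add, map_smul, smul_eq_mul] at h5
  by_contra! h7
  nlinarith

/-- If `facets Λ w` refines the subdivision induced by `y`, then every cell of the latter contains
a cell of the former. -/
theorem exists_facet_subset (h1 : (1 : ι → ℝ) ∈ Λ) {w y : ι → ℝ}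
    (hy : y ∈ heightCone Λ (facets Λ w)) {B : Set ι} (hB : B ∈ facets Λ y) :
    ∃ A ∈ facets Λ w, A ⊆ B := by
  classical
  obtain ⟨m, hm, hym, rfl, hd⟩ := hB
  -- The functional sums over the contact set of `m` with `y`, where `m` attains the lower bound `∑
  -- y`. Optimality of `A` forces the function `l` that meets `y` on `A` to attain it as well, so `l
  -- = m`.
  set s : Finset ι := Finset.univ.filter fun i => y i = m i with hs
  set u : (ι → ℝ) →ₗ[ℝ] ℝ := ∑ i ∈ s, LinearMap.proj i with hu
  have hua : ∀ l, u l = ∑ i ∈ s, l i := fun l => by simp [hu]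
  obtain ⟨A, hA, hopt⟩ := exists_optimal_facet h1 u
    (fun l _ hl => by rw [hua]; exact Finset.sum_nonneg fun i _ => hl i) w
  obtain ⟨l, hl, hyl, hAl⟩ := hy A hA
  have h2 := hopt (m - l) (Λ.sub_mem hm hl) fun i hi => by
    simpa [← hAl i hi] using hym i
  rw [map_sub, hua, hua, sub_nonneg] at h2
  have h3 : ∑ i ∈ s, m i = ∑ i ∈ s, y i :=
    Finset.sum_congr rfl fun i hi => ((Finset.mem_filter.1 hi).2).symm
  rw [h3] at h2
  have h4 := (Finset.sum_eq_sum_iff_of_le (s := s) fun i _ => hyl i).1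
    (le_antisymm (Finset.sum_le_sum fun i _ => hyl i) h2)
  have h5 : m = l := hd.eq hm hl fun i hi => by
    rw [← h4 i (by simpa [hs] using hi)]
    exact (show y i = m i from hi).symm
  refine ⟨A, hA, fun i hi => ?_⟩
  rw [h5]
  exact hAl i hi

/-- The value of `g` is characterized as a minimum that does not mention `w`; this makes the
functionals of different cones agree on overlaps. One optimal facet of `w` serves the whole cone,
which gives linearity. -/
theorem exists_grade (h1 : (1 : ι → ℝ) ∈ Λ) (w : ι → ℝ) :
    ∃ g : (ι → ℝ) →ₗ[ℝ] ℝ, ∀ x ∈ heightCone Λ (facets Λ w),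
      (∃ l ∈ Λ, (∀ i, x i ≤ l i) ∧ g x = ∑ i, (l i - x i)) ∧
      ∀ l ∈ Λ, (∀ i, x i ≤ l i) → g x ≤ ∑ i, (l i - x i) := by
  set u : (ι → ℝ) →ₗ[ℝ] ℝ := ∑ i, LinearMap.proj i with hu
  have hua : ∀ l, u l = ∑ i, l i := fun l => by simp [hu]
  obtain ⟨A, hA, hopt⟩ := exists_optimal_facet h1 u
    (fun l _ hl => by rw [hua]; exact Finset.sum_nonneg fun i _ => hl i) w
  have hd := determines_of_mem_facets hA
  refine ⟨u.comp (interp Λ A - LinearMap.id), fun x hx => ?_⟩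
  obtain ⟨l, hl, hxl, hAl⟩ := hx A hA
  have hg : (u.comp (interp Λ A - LinearMap.id)) x = ∑ i, (l i - x i) := by
    simp [hua, interp_eq hd hl hAl]
  refine ⟨⟨l, hl, hxl, hg⟩, fun m hm hxm => ?_⟩
  have h2 := hopt (m - l) (Λ.sub_mem hm hl) fun i hi => by
    simpa [← hAl i hi] using hxm i
  rw [map_sub, hua, hua] at h2
  rw [hg, Finset.sum_sub_distrib, Finset.sum_sub_distrib]
  linarith

theorem mem_heightCone_facets_of_forall (h1 : (1 : ι → ℝ) ∈ Λ) {w y z : ι → ℝ}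
    (hy : y ∈ heightCone Λ (facets Λ w)) (hz : z ∈ heightCone Λ (facets Λ w))
    (h : ∀ A ∈ facets Λ w, ∀ i, y i = interp Λ A y i → z i = interp Λ A z i) :
    z ∈ heightCone Λ (facets Λ y) := by
  intro B hB
  obtain ⟨A, hA, hAB⟩ := exists_facet_subset h1 hy hB
  have hd := determines_of_mem_facets hA
  obtain ⟨m, hm, h2, rfl, -⟩ := hB
  refine ⟨interp Λ A z, interp_mem hd z,
    ((mem_heightCone_iff fun _ => determines_of_mem_facets).1 hz A hA).1, fun i hi => ?_⟩
  refine h A hA i ?_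
  rw [interp_eq hd hm hAB]
  exact hi

/-- Inequalities of the cone of `w` that are tight at `y` are tight at `z`, and the others leave
slack: `y` is a relative interior point of its own cone. -/
theorem exists_sub_smul_mem {w y z : ι → ℝ} (hy : y ∈ heightCone Λ (facets Λ w))
    (hz : z ∈ heightCone Λ (facets Λ y)) :
    ∃ t : ℝ, 0 < t ∧ y - t • z ∈ heightCone Λ (facets Λ w) := by
  have hdet : ∀ A ∈ facets Λ w, Determines Λ A := fun _ => determines_of_mem_facets
  have hy' := (mem_heightCone_iff hdet).1 hy
  have hz' := (mem_heightCone_iff hdet).1 (heightCone_facets_subset hy hz)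
  obtain ⟨t, ht, h⟩ := exists_small_step
    (a := fun p : facets Λ w × ι => interp Λ p.1 y p.2 - y p.2)
    (b := fun p => z p.2 - interp Λ p.1 z p.2)
    (fun p => sub_nonneg.2 ((hy' p.1 p.1.2).1 p.2))
    (fun p hp => (sub_eq_zero.2
      (interp_eq_of_interp_eq hy hz p.1.2 (sub_eq_zero.1 hp).symm)).ge)
  refine ⟨t, ht, (mem_heightCone_iff hdet).2 fun A hA => ⟨fun i => ?_, fun i hi => ?_⟩⟩
  · have := h (⟨A, hA⟩, i)
    simp only [map_sub, map_smul, Pi.sub_apply, Pi.smul_apply, smul_eq_mul] at this ⊢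
    linarith
  · simp only [map_sub, map_smul, Pi.sub_apply, Pi.smul_apply, smul_eq_mul,
      ← (hy' A hA).2 i hi, ← (hz' A hA).2 i hi]

/-- A subset of a height cone that is closed under addition lies in the height cone of one of its
members. -/
theorem exists_generic (h1 : (1 : ι → ℝ) ∈ Λ) {w : ι → ℝ} {G : Set (ι → ℝ)}
    (hne : G.Nonempty) (hG : G ⊆ heightCone Λ (facets Λ w))
    (hadd : ∀ x ∈ G, ∀ y ∈ G, x + y ∈ G) :
    ∃ y ∈ G, G ⊆ heightCone Λ (facets Λ y) := by
  have hdet : ∀ A ∈ facets Λ w, Determines Λ A := fun _ => determines_of_mem_facets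
  set Z : (ι → ℝ) → Set (Set ι × ι) :=
    fun y => {p | p.1 ∈ facets Λ w ∧ y p.2 = interp Λ p.1 y p.2} with hZ
  -- The generic member has the fewest tight inequalities. A sum is tight only where both summands
  -- are, so its tight inequalities hold with equality on all of `G`.
  have hex : ∃ y ∈ G, ∀ z ∈ G, (Z y).ncard ≤ (Z z).ncard := by
    obtain ⟨N, ⟨y, hy, rfl⟩, hmin⟩ := exists_minimal_of_wellFoundedLT
      (fun N => ∃ y ∈ G, (Z y).ncard = N) ⟨_, hne.choose, hne.choose_spec, rfl⟩
    refine ⟨y, hy, fun z hz => ?_⟩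
    rcases le_total (Z y).ncard (Z z).ncard with h | h
    · exact h
    · exact hmin ⟨z, hz, rfl⟩ h
  obtain ⟨y, hy, hmin⟩ := hex
  refine ⟨y, hy, fun z hz => mem_heightCone_facets_of_forall h1 (hG hy) (hG hz) ?_⟩
  have hyC := (mem_heightCone_iff hdet).1 (hG hy)
  have hzC := (mem_heightCone_iff hdet).1 (hG hz)
  have hsplit : ∀ p ∈ Z (y + z), p ∈ Z y ∧ p ∈ Z z := by
    rintro ⟨A, i⟩ ⟨hA, hi⟩
    simp only [map_add, Pi.add_apply] at hi hA
    have h2 := (hyC A hA).1 i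
    have h3 := (hzC A hA).1 i
    exact ⟨⟨hA, by simp only; linarith⟩, ⟨hA, by simp only; linarith⟩⟩
  have hEq : Z (y + z) = Z y := Set.eq_of_subset_of_ncard_le (fun p hp => (hsplit p hp).1)
    (hmin _ (hadd y hy z hz)) (Set.toFinite _)
  intro A hA i hi
  exact (hsplit (A, i) (hEq ▸ (⟨hA, hi⟩ : (A, i) ∈ Z y))).2.2

theorem isPolyhedralCone_heightCone {T : Set (Set ι)} (hT : ∀ A ∈ T, Determines Λ A) :
    ∃ (κ : Type) (_ : Finite κ) (α : κ → (ι → ℝ) →ₗ[ℝ] ℝ),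
      (∀ a, ∀ l ∈ Λ, α a l = 0) ∧ heightCone Λ T = {x | ∀ a, 0 ≤ α a x} := by
  refine ⟨(T × ι) ⊕ (Σ A : T, A.1), inferInstance,
    Sum.elim (fun p => (LinearMap.proj p.2).comp (interp Λ p.1 - LinearMap.id))
      (fun p => (LinearMap.proj p.2.1).comp (LinearMap.id - interp Λ p.1)), ?_, ?_⟩
  · rintro (p | p) l hl
    · simp [interp_eq (hT p.1 p.1.2) hl fun _ _ => rfl]
    · simp [interp_eq (hT p.1 p.1.2) hl fun _ _ => rfl]
  · ext x
    rw [mem_heightCone_iff hT]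
    constructor
    · rintro h (p | p)
      · simpa using (h p.1 p.1.2).1 p.2
      · simpa using ((h p.1 p.1.2).2 p.2.1 p.2.2).ge
    · intro h A hA
      have h2 : ∀ i, x i ≤ interp Λ A x i := fun i => by
        simpa using h (Sum.inl (⟨A, hA⟩, i))
      refine ⟨h2, fun i hi => le_antisymm (h2 i) ?_⟩
      simpa using h (Sum.inr ⟨⟨A, hA⟩, ⟨i, hi⟩⟩)

/-- The functional cutting out the face of a height cone that belongs to one of its members. -/
theorem exists_face_functional (h1 : (1 : ι → ℝ) ∈ Λ) {w y : ι → ℝ}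
    (hy : y ∈ heightCone Λ (facets Λ w)) :
    ∃ ψ : (ι → ℝ) →ₗ[ℝ] ℝ, (∀ l ∈ Λ, ψ l = 0) ∧
      (∀ x ∈ heightCone Λ (facets Λ w), ψ x ≤ 0) ∧
      heightCone Λ (facets Λ y) = {x ∈ heightCone Λ (facets Λ w) | ψ x = 0} := by
  classical
  have hdet : ∀ A ∈ facets Λ w, Determines Λ A := fun _ => determines_of_mem_facets
  set s : Finset (Set ι × ι) :=
    Finset.univ.filter fun p => p.1 ∈ facets Λ w ∧ y p.2 = interp Λ p.1 y p.2 with hs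
  have hmem : ∀ p, p ∈ s ↔ p.1 ∈ facets Λ w ∧ y p.2 = interp Λ p.1 y p.2 := fun p => by
    simp [hs]
  -- The sum of all constraints tight at `y`. Each term is nonpositive on the cone, so the sum
  -- vanishes only when every term does.
  set ψ : (ι → ℝ) →ₗ[ℝ] ℝ :=
    ∑ p ∈ s, (LinearMap.proj p.2).comp (LinearMap.id - interp Λ p.1) with hψ
  have hψa : ∀ x, ψ x = ∑ p ∈ s, (x p.2 - interp Λ p.1 x p.2) := fun x => by simp [hψ]
  have hle : ∀ x ∈ heightCone Λ (facets Λ w), ∀ p ∈ s, x p.2 - interp Λ p.1 x p.2 ≤ 0 :=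
    fun x hx p hp => sub_nonpos.2
      (((mem_heightCone_iff hdet).1 hx p.1 ((hmem p).1 hp).1).1 p.2)
  refine ⟨ψ, fun l hl => ?_, fun x hx => ?_, Set.ext fun x => ⟨fun hx => ?_, ?_⟩⟩
  · rw [hψa]
    refine Finset.sum_eq_zero fun p hp => ?_
    rw [interp_eq (hdet p.1 ((hmem p).1 hp).1) hl fun _ _ => rfl, sub_self]
  · rw [hψa]
    exact Finset.sum_nonpos (hle x hx)
  · refine ⟨heightCone_facets_subset hy hx, ?_⟩
    rw [hψa]
    exact Finset.sum_eq_zero fun p hp => sub_eq_zero.2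
      (interp_eq_of_interp_eq hy hx ((hmem p).1 hp).1 ((hmem p).1 hp).2)
  · rintro ⟨hx, hx0⟩
    rw [hψa, Finset.sum_eq_zero_iff_of_nonpos (hle x hx)] at hx0
    exact mem_heightCone_facets_of_forall h1 hy hx fun A hA i hi =>
      sub_eq_zero.1 (hx0 (A, i) ((hmem (A, i)).2 ⟨hA, hi⟩))

end Facets

end TropSec

namespace TropSec

/-! ### Affine functionals on the columns of a matrix -/

section Columns

variable {n d : ℕ} {L : Submodule ℝ (TP n)} {M : Matrix (Fin d) (Fin n) ℝ}

theorem proj_one : proj n 1 = 0 :=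
  (Submodule.Quotient.mk_eq_zero _).2 (Submodule.mem_span_singleton_self _)

theorem proj_eq_zero_iff {x : Fin n → ℝ} :
    proj n x = 0 ↔ ∃ c : ℝ, c • (1 : Fin n → ℝ) = x :=
  (Submodule.Quotient.mk_eq_zero _).trans Submodule.mem_span_singleton

theorem linear_apply_eq_sum (φ : (Fin d → ℝ) →ₗ[ℝ] ℝ) (v : Fin d → ℝ) :
    φ v = ∑ a, φ (Pi.single a 1) * v a := by
  conv_lhs => rw [← Finset.univ_sum_single v, map_sum]
  refine Finset.sum_congr rfl fun a _ => ?_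
  rw [show (Pi.single a (v a) : Fin d → ℝ) = v a • Pi.single a 1 by
    rw [← Pi.single_smul, smul_eq_mul, mul_one], map_smul, smul_eq_mul, mul_comm]

theorem affine_columns_eq (M : Matrix (Fin d) (Fin n) ℝ) (f : (Fin d → ℝ) →ᵃ[ℝ] ℝ) :
    (fun i => f (columns M i)) =
      ∑ a, f.linear (Pi.single a 1) • M a + f 0 • (1 : Fin n → ℝ) := by
  funext i
  have h : f (columns M i) = f.linear (columns M i) + f 0 := by
    conv_lhs => rw [AffineMap.decomp f]
    rfl
  rw [h, linear_apply_eq_sum]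
  simp [columns]

theorem affine_columns_mem
    (hL : Submodule.span ℝ (Set.range (fun a : Fin d => proj n (M a))) = L)
    (f : (Fin d → ℝ) →ᵃ[ℝ] ℝ) : (fun i => f (columns M i)) ∈ L.comap (proj n) := by
  rw [affine_columns_eq, Submodule.mem_comap, map_add, map_sum, map_smul, proj_one, smul_zero,
    add_zero, ← hL]
  refine Submodule.sum_mem _ fun a _ => ?_
  rw [map_smul]
  exact Submodule.smul_mem _ _ (Submodule.subset_span ⟨a, rfl⟩)

theorem exists_affine_columns_eq
    (hL : Submodule.span ℝ (Set.range (fun a : Fin d => proj n (M a))) = L)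
    {l : Fin n → ℝ} (hl : l ∈ L.comap (proj n)) :
    ∃ f : (Fin d → ℝ) →ᵃ[ℝ] ℝ, ∀ i, f (columns M i) = l i := by
  rw [Submodule.mem_comap, ← hL, Submodule.mem_span_range_iff_exists_fun] at hl
  obtain ⟨c, hc⟩ := hl
  have h0 : proj n (l - ∑ a, c a • M a) = 0 := by
    rw [map_sub, map_sum, ← hc]
    simp
  obtain ⟨b, hb⟩ := proj_eq_zero_iff.1 h0
  refine ⟨(∑ a, c a • (LinearMap.proj a : (Fin d → ℝ) →ₗ[ℝ] ℝ)).toAffineMap +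
    AffineMap.const ℝ _ b, fun i => ?_⟩
  have := congrFun hb i
  simp only [Pi.smul_apply, Pi.one_apply, smul_eq_mul, mul_one, Pi.sub_apply,
    Finset.sum_apply] at this
  simp [columns, this]

theorem affine_eq_zero_of_columns (hn : 0 < n)
    (hM : LinearIndependent ℝ (fun a : Fin d => proj n (M a))) {f : (Fin d → ℝ) →ᵃ[ℝ] ℝ}
    (hf : ∀ i, f (columns M i) = 0) : f = 0 := by
  have h := affine_columns_eq M f
  rw [show (fun i => f (columns M i)) = 0 from funext hf] at h
  have h' := congrArg (proj n) h
  rw [map_add, map_sum, map_smul, proj_one, smul_zero, add_zero, map_zero] at h'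
  simp only [map_smul] at h'
  have hc := Fintype.linearIndependent_iff.1 hM _ h'.symm
  -- Linear independence modulo constants removes the linear part; a label is needed to see that the
  -- constant term vanishes.
  have h0 : f 0 = 0 := by
    have := congrFun h ⟨0, hn⟩
    simpa [hc] using this.symm
  ext x
  have hx : f x = f.linear x + f 0 := by
    conv_lhs => rw [AffineMap.decomp f]
    rfl
  rw [hx, h0, linear_apply_eq_sum]
  simp [hc]

/-- A proper direction space lies in the kernel of a nonzero functional. The constant functional `1`
rules out the empty set. -/
theorem affineSpan_eq_top_iff {V : Type*} [AddCommGroup V] [Module ℝ V] {S : Set V} :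
    affineSpan ℝ S = ⊤ ↔ ∀ f : V →ᵃ[ℝ] ℝ, (∀ p ∈ S, f p = 0) → f = 0 := by
  constructor
  · intro h f hf
    exact AffineMap.ext_on h fun p hp => hf p hp
  · intro h
    rcases S.eq_empty_or_nonempty with rfl | ⟨p, hp⟩
    · have := h (AffineMap.const ℝ V 1) (by simp)
      exact absurd (congrArg (fun f : V →ᵃ[ℝ] ℝ => f 0) this) (by simp)
    have hpS := subset_affineSpan ℝ S hp
    rw [← AffineSubspace.direction_eq_top_iff_of_nonempty ⟨p, hpS⟩]
    by_contra hne
    obtain ⟨φ, hφ, hle⟩ := Submodule.exists_le_ker_of_lt_top _ (lt_top_iff_ne_top.2 hne)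
    refine hφ ?_
    have h0 := h (φ.toAffineMap - AffineMap.const ℝ V (φ p)) fun q hq => by
      have := hle (AffineSubspace.vsub_mem_direction (subset_affineSpan ℝ S hq) hpS)
      simpa using this
    have h1 := congrArg AffineMap.linear h0
    simpa using h1

theorem upperFacets_columns (hn : 0 < n)
    (hM : LinearIndependent ℝ (fun a : Fin d => proj n (M a)))
    (hL : Submodule.span ℝ (Set.range (fun a : Fin d => proj n (M a))) = L) (x : Fin n → ℝ) :
    upperFacets (columns M) x = facets (L.comap (proj n)) x := by
  have hspan : ∀ A : Set (Fin n),
      affineSpan ℝ (columns M '' A) = ⊤ ↔ Determines (L.comap (proj n)) A := by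
    intro A
    rw [affineSpan_eq_top_iff]
    constructor
    · intro h l hl hA
      obtain ⟨f, hf⟩ := exists_affine_columns_eq hL hl
      have hf0 : f = 0 := h f (by rintro _ ⟨i, hi, rfl⟩; rw [hf, hA i hi])
      funext i
      rw [← hf i, hf0]
      rfl
    · intro h f hf
      exact affine_eq_zero_of_columns hn hM
        (congrFun (h _ (affine_columns_mem hL f) fun i hi => hf _ ⟨i, hi, rfl⟩))
  ext A
  constructor
  · rintro ⟨f, h1, h2, h3⟩
    exact ⟨_, affine_columns_mem hL f, h1, h2, (hspan A).1 h3⟩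
  · rintro ⟨l, hl, h1, h2, h3⟩
    obtain ⟨f, hf⟩ := exists_affine_columns_eq hL hl
    exact ⟨f, fun i => (hf i).symm ▸ h1 i, by simpa [hf] using h2, (hspan A).2 h3⟩

end Columns

/-! ### The secondary fan and the secant complex -/

section Secant

variable {n : ℕ} {L : Submodule ℝ (TP n)}

theorem one_mem_comap_proj : (1 : Fin n → ℝ) ∈ L.comap (proj n) := by
  rw [Submodule.mem_comap, proj_one]
  exact L.zero_mem

theorem proj_surjective (p : TP n) : ∃ x, proj n x = p := Submodule.mkQ_surjective _ p

theorem exists_descend {f : (Fin n → ℝ) →ₗ[ℝ] ℝ} (hf : f 1 = 0) :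
    ∃ f' : TP n →ₗ[ℝ] ℝ, ∀ x, f' (proj n x) = f x := by
  refine ⟨Submodule.liftQ _ f ?_, fun x => Submodule.liftQ_apply _ _ _⟩
  rw [Submodule.span_singleton_le_iff_mem]
  exact hf

/-- The image in tropical projective space of a height cone. -/
def projCone (L : Submodule ℝ (TP n)) (T : Set (Set (Fin n))) : Set (TP n) :=
  proj n '' heightCone (L.comap (proj n)) T

theorem proj_mem_projCone {T : Set (Set (Fin n))} {x : Fin n → ℝ} :
    proj n x ∈ projCone L T ↔ x ∈ heightCone (L.comap (proj n)) T := by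
  refine ⟨?_, fun h => ⟨x, h, rfl⟩⟩
  rintro ⟨y, hy, hxy⟩
  have hmem : x - y ∈ L.comap (proj n) := by
    rw [Submodule.mem_comap, map_sub, hxy, sub_self]
    exact L.zero_mem
  have := heightCone_add_mem (subset_heightCone T hmem) hy
  rwa [sub_add_cancel] at this

theorem refines_facets_iff {w x : Fin n → ℝ} :
    Refines (facets (L.comap (proj n)) w) (facets (L.comap (proj n)) x) ↔
      projCone L (facets (L.comap (proj n)) x) ⊆ projCone L (facets (L.comap (proj n)) w) := by
  have h := mem_heightCone_iff_refines (Λ := L.comap (proj n)) (x := x)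
    (T := facets (L.comap (proj n)) w) fun _ => determines_of_mem_facets
  refine h.symm.trans ⟨fun h => Set.image_mono (heightCone_facets_subset h), fun h => ?_⟩
  exact proj_mem_projCone.1 (h ⟨x, mem_heightCone_facets_self x, rfl⟩)

theorem facets_eq_of_projCone_eq {w x : Fin n → ℝ}
    (h : projCone L (facets (L.comap (proj n)) w) = projCone L (facets (L.comap (proj n)) x)) :
    facets (L.comap (proj n)) w = facets (L.comap (proj n)) x := by
  have key : ∀ {w x : Fin n → ℝ},
      projCone L (facets (L.comap (proj n)) w) = projCone L (facets (L.comap (proj n)) x) →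
      facets (L.comap (proj n)) w ⊆ facets (L.comap (proj n)) x := by
    intro w x h A hA
    obtain ⟨B, hB, hAB⟩ := refines_facets_iff.2 h.ge A hA
    obtain ⟨A', hA', hBA⟩ := refines_facets_iff.2 h.le B hB
    have h1 : A = A' := facets_antichain hA hA' (hAB.trans hBA)
    rwa [hAB.antisymm (h1 ▸ hBA)]
  exact (key h).antisymm (key h.symm)

theorem CoveredBy.of_refines {m : ℕ} {S T : Set (Set (Fin n))} (hS : CoveredBy m S)
    (h : Refines S T) : CoveredBy m T := by
  obtain ⟨A, hA, hu⟩ := hS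
  choose B hB hAB using fun j => h (A j) (hA j)
  exact ⟨B, hB, Set.eq_univ_of_subset (Set.iUnion_mono hAB) hu⟩

theorem exists_eq_tropSum_iff {k : ℕ} {x : Fin n → ℝ} :
    (∃ y : Fin (k + 1) → Fin n → ℝ, (∀ j, proj n (y j) ∈ L) ∧ x = tropSum y) ↔
      CoveredBy (k + 1) (facets (L.comap (proj n)) x) := by
  constructor
  · rintro ⟨y, hy, rfl⟩
    have hle : ∀ j i, tropSum y i ≤ y j i := fun j i =>
      Finset.inf'_le (fun j => y j i) (Finset.mem_univ j)
    choose A hA hsub using fun j =>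
      exists_facet_superset (Λ := L.comap (proj n)) (hy j) (hle j)
    refine ⟨A, hA, Set.eq_univ_of_forall fun i => ?_⟩
    obtain ⟨j, -, hj⟩ := Finset.exists_mem_eq_inf' Finset.univ_nonempty (fun j => y j i)
    exact Set.mem_iUnion.2 ⟨j, hsub j hj⟩
  · rintro ⟨A, hA, hu⟩
    choose l hl h1 h2 h3 using hA
    refine ⟨l, hl, funext fun i => le_antisymm ?_ ?_⟩
    · exact Finset.le_inf' _ _ fun j _ => h1 j i
    · obtain ⟨j, hj⟩ := Set.mem_iUnion.1 (hu.symm ▸ Set.mem_univ i : i ∈ ⋃ j, A j)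
      rw [h2 j] at hj
      rw [show x i = l j i from hj]
      exact Finset.inf'_le (fun j => l j i) (Finset.mem_univ j)

variable (L) in
/-- The regular subdivisions, relative to `L`, with all points in `m` of their facets. -/
abbrev CoveredSubdivision (m : ℕ) : Type :=
  {T : Set (Set (Fin n)) // (∃ x, T = facets (L.comap (proj n)) x) ∧ CoveredBy m T}

instance (m : ℕ) : Finite (CoveredSubdivision L m) := Subtype.finite

theorem isPolyhedralCone_projCone (w : Fin n → ℝ) :
    IsPolyhedralCone (projCone L (facets (L.comap (proj n)) w)) := by
  obtain ⟨κ, hκ, α, hα, hC⟩ := isPolyhedralCone_heightCone (Λ := L.comap (proj n))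
    (T := facets (L.comap (proj n)) w) fun _ => determines_of_mem_facets
  choose β hβ using fun a => exists_descend (hα a 1 one_mem_comap_proj)
  refine ⟨κ, hκ, β, Set.ext fun p => ?_⟩
  obtain ⟨x, rfl⟩ := proj_surjective p
  rw [proj_mem_projCone, hC]
  exact forall_congr' fun a => by rw [hβ]

theorem exists_projCone_grade (w : Fin n → ℝ) :
    ∃ g : TP n →ₗ[ℝ] ℝ, ∀ x ∈ heightCone (L.comap (proj n)) (facets (L.comap (proj n)) w),
      (∃ l ∈ L.comap (proj n), (∀ i, x i ≤ l i) ∧ g (proj n x) = ∑ i, (l i - x i)) ∧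
      ∀ l ∈ L.comap (proj n), (∀ i, x i ≤ l i) → g (proj n x) ≤ ∑ i, (l i - x i) := by
  obtain ⟨g, hg⟩ := exists_grade (Λ := L.comap (proj n)) one_mem_comap_proj w
  have h1 : g 1 = 0 := by
    obtain ⟨⟨l, -, h1, h2⟩, h3⟩ := hg 1 (subset_heightCone _ one_mem_comap_proj)
    refine le_antisymm ((h3 1 one_mem_comap_proj fun _ => le_rfl).trans (by simp)) ?_
    rw [h2]
    exact Finset.sum_nonneg fun i _ => sub_nonneg.2 (h1 i)
  obtain ⟨g', hg'⟩ := exists_descend h1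
  exact ⟨g', fun x hx => by simpa only [hg'] using hg x hx⟩

theorem isFace_projCone {w y : Fin n → ℝ}
    (hy : y ∈ heightCone (L.comap (proj n)) (facets (L.comap (proj n)) w)) :
    IsFace (projCone L (facets (L.comap (proj n)) y))
      (projCone L (facets (L.comap (proj n)) w)) := by
  obtain ⟨ψ, h0, h1, h2⟩ := exists_face_functional one_mem_comap_proj hy
  obtain ⟨φ, hφ⟩ := exists_descend (h0 1 one_mem_comap_proj)
  refine ⟨φ, 0, ?_, Set.ext fun p => ?_⟩
  · rintro _ ⟨x, hx, rfl⟩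
    rw [hφ]
    exact h1 x hx
  · obtain ⟨x, rfl⟩ := proj_surjective p
    rw [proj_mem_projCone, h2, Set.mem_ofPred_eq, Set.mem_ofPred_eq, proj_mem_projCone, hφ]

theorem exists_eq_projCone_of_isFace {w : Fin n → ℝ} {F : Set (TP n)} (hne : F.Nonempty)
    (hF : IsFace F (projCone L (facets (L.comap (proj n)) w))) :
    ∃ y ∈ heightCone (L.comap (proj n)) (facets (L.comap (proj n)) w),
      F = projCone L (facets (L.comap (proj n)) y) := by
  obtain ⟨φ, c, hφ, rfl⟩ := hF
  have hC := isPolyhedralCone_projCone (L := L) w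
  -- Scaling by zero gives `0 ≤ c`; doubling a point where `φ = c` gives `2 * c ≤ c`.
  have hc : c = 0 := by
    obtain ⟨p, hp, hpc⟩ := hne
    have h1 := hφ _ (hC.smul_mem hp (t := 0) le_rfl)
    have h2 := hφ _ (hC.add_mem hp hp)
    simp only [zero_smul, map_zero, map_add] at h1 h2
    linarith
  subst hc
  obtain ⟨p, hp, hp0⟩ := hne
  obtain ⟨x, rfl⟩ := proj_surjective p
  obtain ⟨y, ⟨hy, hy0⟩, hG⟩ := exists_generic one_mem_comap_proj (Λ := L.comap (proj n)) (w := w)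
    (G := {x | x ∈ heightCone (L.comap (proj n)) (facets (L.comap (proj n)) w) ∧
      φ (proj n x) = 0}) ⟨x, proj_mem_projCone.1 hp, hp0⟩ (fun x hx => hx.1)
    (fun x hx y hy => ⟨heightCone_add_mem hx.1 hy.1, by
      rw [map_add, map_add, hx.2, hy.2, add_zero]⟩)
  refine ⟨y, hy, Set.Subset.antisymm ?_ ?_⟩
  · rintro q ⟨hq, hq0⟩
    obtain ⟨z, rfl⟩ := proj_surjective q
    exact proj_mem_projCone.2 (hG ⟨proj_mem_projCone.1 hq, hq0⟩)
  · rintro _ ⟨z, hz, rfl⟩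
    have hzC := proj_mem_projCone.2 (heightCone_facets_subset hy hz)
    refine ⟨hzC, le_antisymm (hφ _ hzC) ?_⟩
    -- Since `φ` vanishes at `y`, the bound `φ ≤ 0` at `y - t • z` yields `φ z ≥ 0`.
    obtain ⟨t, ht, hmem⟩ := exists_sub_smul_mem hy hz
    have := hφ _ (proj_mem_projCone.2 hmem)
    rw [map_sub, map_sub, hy0, map_smul, map_smul, smul_eq_mul] at this
    nlinarith

theorem exists_inter_eq_projCone (w w' : Fin n → ℝ) :
    ∃ y ∈ heightCone (L.comap (proj n)) (facets (L.comap (proj n)) w),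
      projCone L (facets (L.comap (proj n)) w) ∩ projCone L (facets (L.comap (proj n)) w') =
        projCone L (facets (L.comap (proj n)) y) := by
  obtain ⟨y, ⟨hy, hy'⟩, hG⟩ := exists_generic one_mem_comap_proj (Λ := L.comap (proj n)) (w := w)
    (G := heightCone (L.comap (proj n)) (facets (L.comap (proj n)) w) ∩
      heightCone (L.comap (proj n)) (facets (L.comap (proj n)) w'))
    ⟨0, subset_heightCone _ (Submodule.zero_mem _), subset_heightCone _ (Submodule.zero_mem _)⟩
    Set.inter_subset_left
    (fun x hx y hy => ⟨heightCone_add_mem hx.1 hy.1, heightCone_add_mem hx.2 hy.2⟩)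
  refine ⟨y, hy, Set.Subset.antisymm ?_ ?_⟩
  · rintro q ⟨hq, hq'⟩
    obtain ⟨z, rfl⟩ := proj_surjective q
    exact proj_mem_projCone.2 (hG ⟨proj_mem_projCone.1 hq, proj_mem_projCone.1 hq'⟩)
  · exact Set.subset_inter (Set.image_mono (heightCone_facets_subset hy))
      (Set.image_mono (heightCone_facets_subset hy'))

/-- The secondary cones of the covered subdivisions form a graded fan; the grade of `x` is the
least total excess over `x` of a function in `L` above `x`. -/
theorem exists_isGradedFan (L : Submodule ℝ (TP n)) (k : ℕ) :
    ∃ g : CoveredSubdivision L (k + 1) → TP n →ₗ[ℝ] ℝ,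
      IsGradedFan L (fun T => projCone L T.1) g := by
  choose g hg using exists_projCone_grade (L := L)
  choose w hw using fun T : CoveredSubdivision L (k + 1) => T.2.1
  have hle : ∀ T : Set (Set (Fin n)), (L : Set (TP n)) ⊆ projCone L T := by
    intro T p hp
    obtain ⟨x, rfl⟩ := proj_surjective p
    exact ⟨x, subset_heightCone T hp, rfl⟩
  have hgrade : ∀ T : CoveredSubdivision L (k + 1), ∀ x ∈ heightCone (L.comap (proj n)) T.1, _ := fun T x hx =>
    hg (w T) x (hw T ▸ hx)
  refine ⟨fun T => g (w T), ?_, ?_, ?_, ?_, ?_, ?_, ?_, ?_⟩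
  · intro T
    rw [hw T]
    exact isPolyhedralCone_projCone _
  · exact fun T => hle T.1
  · intro T p hp
    obtain ⟨x, rfl⟩ := proj_surjective p
    obtain ⟨⟨l, -, h1, h2⟩, h3⟩ := hgrade T x (subset_heightCone _ hp)
    refine le_antisymm ((h3 x hp fun _ => le_rfl).trans (by simp)) ?_
    rw [h2]
    exact Finset.sum_nonneg fun i _ => sub_nonneg.2 (h1 i)
  · rintro T _ ⟨x, hx, rfl⟩ hxL
    obtain ⟨⟨l, hl, h1, h2⟩, -⟩ := hgrade T x hx
    rw [h2]
    refine lt_of_le_of_ne (Finset.sum_nonneg fun i _ => sub_nonneg.2 (h1 i)) fun h => hxL ?_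
    have h0 := (Finset.sum_eq_zero_iff_of_nonneg fun i _ => sub_nonneg.2 (h1 i)).1 h.symm
    rwa [show x = l from funext fun i => (sub_eq_zero.1 (h0 i (Finset.mem_univ i))).symm]
  · rintro T T' _ ⟨x, hx, rfl⟩ hx'
    obtain ⟨⟨l, hl, h1, h2⟩, h3⟩ := hgrade T x hx
    obtain ⟨⟨l', hl', h1', h2'⟩, h3'⟩ := hgrade T' x (proj_mem_projCone.1 hx')
    exact le_antisymm ((h3 l' hl' h1').trans h2'.ge) ((h3' l hl h1).trans h2.ge)
  · intro T T'
    simp only [hw T, hw T']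
    obtain ⟨y, hy, h⟩ := exists_inter_eq_projCone (L := L) (w T) (w T')
    rw [h]
    exact isFace_projCone hy
  · intro T F hne hF
    simp only [hw T] at hF
    obtain ⟨y, hy, h⟩ := exists_eq_projCone_of_isFace hne hF
    refine ⟨⟨_, ⟨y, rfl⟩, T.2.2.of_refines ?_⟩, h⟩
    rw [hw T]
    exact (mem_heightCone_iff_refines fun _ => determines_of_mem_facets).1 hy
  · refine ⟨⟨_, ⟨0, rfl⟩, fun _ => Set.univ, fun _ => ?_, Set.iUnion_const _⟩, ?_⟩
    · rw [facets_zero]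
      rfl
    · simp only [facets_zero, projCone, heightCone_univ]
      exact Set.image_preimage_eq _ proj_surjective

theorem secantVariety_eq_iUnion (L : Submodule ℝ (TP n)) (k : ℕ) :
    secantVariety k L = ⋃ T : CoveredSubdivision L (k + 1), projCone L T.1 := by
  ext p
  rw [Set.mem_iUnion]
  constructor
  · rintro ⟨y, hy, rfl⟩
    exact ⟨⟨_, ⟨_, rfl⟩, exists_eq_tropSum_iff.1 ⟨y, hy, rfl⟩⟩,
      proj_mem_projCone.2 (mem_heightCone_facets_self _)⟩
  · rintro ⟨⟨_, ⟨w, rfl⟩, hT⟩, x, hx, rfl⟩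
    obtain ⟨y, hy, rfl⟩ := exists_eq_tropSum_iff.2 (hT.of_refines
      ((mem_heightCone_iff_refines fun _ => determines_of_mem_facets).1 hx))
    exact ⟨y, hy, rfl⟩

end Secant

end TropSec

/-! ### The secant complex as a slice of the secondary fan -/

theorem corollary2p2 (n d k : ℕ) (hn : 0 < n)
    (L : Submodule ℝ (TropSec.TP n)) (M : Matrix (Fin d) (Fin n) ℝ)
    (hM : LinearIndependent ℝ (fun a : Fin d => TropSec.proj n (M a)))
    (hL : Submodule.span ℝ (Set.range (fun a : Fin d => TropSec.proj n (M a))) = L) :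
    ∃ K : TropSec.PolytopalComplex (TropSec.TP n),
      TropSec.secantVariety k L = TropSec.coneFrom L K.support ∧
      TropSec.ProperConeFrom L K.support ∧
      (∃ e : {F : Set (TropSec.TP n) // F ∈ K.faces} ≃
          {T : Set (Set (Fin n)) // TropSec.IsRegularSubdivision (TropSec.columns M) T ∧
            TropSec.CoveredBy (k + 1) T},
        (∀ F G, G.1 ⊆ F.1 ↔ TropSec.Refines (e F).1 (e G).1) ∧
        (∀ F, TropSec.coneFrom L F.1 =
          TropSec.secondaryCone (TropSec.columns M) (e F).1)) ∧
      TropSec.IsSubcomplex {C | ∃ F ∈ K.faces, C = TropSec.coneFrom L F}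
        (TropSec.secondaryFan (TropSec.columns M)) := by
  open TropSec in
  obtain ⟨g, hg⟩ := exists_isGradedFan L k
  obtain ⟨W, hW⟩ := L.exists_isCompl
  have hup := upperFacets_columns hn hM hL
  have hreg : ∀ T, IsRegularSubdivision (columns M) T ↔
      ∃ x, T = facets (L.comap (proj n)) x := fun T => by
    simp only [IsRegularSubdivision, hup]
  have hsec : ∀ w, secondaryCone (columns M) (facets (L.comap (proj n)) w) =
      projCone L (facets (L.comap (proj n)) w) := by
    intro w
    ext p
    simp only [secondaryCone, hup, projCone, Set.mem_ofPred_eq, Set.mem_image]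
    refine exists_congr fun x => ?_
    rw [mem_heightCone_iff_refines fun _ => determines_of_mem_facets]
    exact ⟨fun h => ⟨h.2, h.1.symm⟩, fun h => ⟨h.2.symm, h.1⟩⟩
  have hsecT : ∀ T : CoveredSubdivision L (k + 1),
      secondaryCone (columns M) T.1 = projCone L T.1 := by
    rintro ⟨_, ⟨w, rfl⟩, -⟩
    exact hsec w
  set σ : CoveredSubdivision L (k + 1) → Set (TP n) :=
    fun T => slice W (projCone L T.1) (g T) with hσ
  have hσle : ∀ S T, σ S ⊆ σ T ↔ projCone L S.1 ⊆ projCone L T.1 := fun S T =>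
    hg.slice_subset_slice_iff hW
  -- A slice recovers its cone, and a cone its subdivision, because facets form an antichain.
  have hinj : Function.Injective σ := by
    rintro ⟨_, ⟨w, rfl⟩, hS⟩ ⟨_, ⟨x, rfl⟩, hT⟩ h
    exact Subtype.ext (facets_eq_of_projCone_eq
      (((hσle _ _).1 h.le).antisymm ((hσle _ _).1 h.ge)))
  have hcone : ∀ T, coneFrom L (σ T) = secondaryCone (columns M) T.1 := fun T =>
    (hg.coneFrom_slice hW T).trans (hsecT T).symm
  obtain ⟨e, he⟩ : ∃ e : {F // F ∈ (hg.complex hW).faces} ≃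
      {T // IsRegularSubdivision (columns M) T ∧ CoveredBy (k + 1) T},
      ∀ F, ∃ T, F.1 = σ T ∧ (e F).1 = T.1 := by
    refine ⟨(Equiv.ofInjective σ hinj).symm.trans
      (Equiv.subtypeEquivRight fun T => and_congr_left' (hreg T).symm), fun F => ?_⟩
    exact ⟨(Equiv.ofInjective σ hinj).symm F,
      (Equiv.apply_ofInjective_symm hinj F).symm, rfl⟩
  refine ⟨hg.complex hW, ?_, hg.properConeFrom_support hW, ⟨e, ?_, ?_⟩, ?_⟩
  · rw [hg.coneFrom_support hW, secantVariety_eq_iUnion]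
  · intro F G
    obtain ⟨S, hFS, hS⟩ := he F
    obtain ⟨T, hGT, hT⟩ := he G
    rw [hFS, hGT, hS, hT, hσle]
    obtain ⟨_, ⟨w, rfl⟩, -⟩ := S
    obtain ⟨_, ⟨x, rfl⟩, -⟩ := T
    exact refines_facets_iff.symm
  · intro F
    obtain ⟨T, hFT, hT⟩ := he F
    rw [hFT, hT, hcone]
  · constructor
    · rintro _ ⟨_, ⟨T, rfl⟩, rfl⟩
      exact ⟨T.1, (hreg T.1).2 T.2.1, hcone T⟩
    · rintro _ ⟨_, ⟨T, rfl⟩, rfl⟩ F hne hF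
      rw [hg.coneFrom_slice hW T] at hF
      obtain ⟨S, rfl⟩ := hg.face T F hne hF
      exact ⟨σ S, ⟨S, rfl⟩, (hg.coneFrom_slice hW S).symm⟩
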